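/- \textbf{Network.} A helper at the centre of the unit square serves $n$ user terminals (UTs) placed independently and uniformly in the square. Transmissions have range $\rho_n=\Theta(\sqrt{\log n/n})$, guard zone factor $\Delta>0$ and constant total bandwidth $W>0$. The square is divided into $K_n^2$ square-lets of side $1/K_n=C_1\rho_n$, where $0<C_1<1/\sqrt5$ is a constant (so that UTs in neighbouring square-lets are within range), and of area at least $a\log n/n$ for a constant $a>1$. A UT is joined to the helper by a route with one UT per square-let, which moves by horizontal and vertical steps, each closer to the helper, through square-lets that meet the straight segment from the UT to the helper. Square-lets at distance $C_2=(2+\Delta)/C_1$ square-lets from each other transmit simultaneously, so the network carries $W/(C_2C_1\rho_n)^2$ bit-hops per unit of time. \textbf{Contents and caches.} There are $m\sim C_3n^{\alpha}$ contents, $C_3>0$, and requests follow the Zipf law $\mathrm P[r=i]=i^{-s}/\sum_{j=1}^m j^{-s}$ with $s>1$. Let $h$ be the smallest integer with $\mathrm P[r\le h]\ge 1-1/\sqrt n$; the contents $1,\dots,h$ are called popular. In decentralized uncoded caching each UT, independently of the others, stores a uniformly random set of $\min(M,h)$ distinct popular contents, where $M\sim C_4n^{\beta}$, $C_4>0$.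 A requested content travels from the first UT on the route (beginning with the requesting UT, at $0$ hops) that stores it, or from the helper if there is none. Let $\mathbb E[x]$ be the average number of hops travelled, over the requesting UT, the request and the cache contents. A per-node data rate $\lambda$ is sustained by a placement of the UTs if every UT has such a route and, for every choice of such routes, $n\lambda\,\mathbb E[x]\le W/(C_2C_1\rho_n)^2$. A sequence of rates is achievable if the probability that it is sustained by the random placement of the UTs tends to $1$ as $n\to\infty$. \textbf{Statement.} If $\alpha>\frac1{2(s-1)}$ and $\beta\le\frac1s(\alpha+\frac12)$, then the following per-node capacity is achievable through decentralized uncoded caching: there are positive achievable rates $$\lambda_n=\Theta\!\left(n^{\beta-\frac1s(\alpha+\frac12)}\,\frac1{(\log n)^2}\right).$$ -/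

import Mathlib

open Filter Topology MeasureTheory Asymptotics

namespace Femtocache

noncomputable section

/-! ### Content popularity -/

/-- Zipf popularity with exponent `s` on the contents `1, …, m`: the probability that a request is
for content `r`. -/
def zipf (s : ℝ) (m r : ℕ) : ℝ :=
  (r : ℝ) ^ (-s) / ∑ j ∈ Finset.Icc 1 m, (j : ℝ) ^ (-s)

/-- `h_ε`: the smallest `h` such that a request falls in `{1, …, h}` with probability at least
`1 - ε`. -/
def popularCount (s : ℝ) (m : ℕ) (ε : ℝ) : ℕ :=
  sInf {h : ℕ | h ≤ m ∧ 1 - ε ≤ ∑ r ∈ Finset.Icc 1 h, zipf s m r}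

/-- The highly popular contents `{1, …, h_ε}`. -/
def popular (s : ℝ) (m : ℕ) (ε : ℝ) : Finset ℕ :=
  Finset.Icc 1 (popularCount s m ε)

/-! ### Decentralized uncoded caching -/

/-- All placements in which each of the `n` user terminals stores `M` different popular contents
(all of them, if there are fewer than `M`). The uniform distribution on this finite set is the
random decentralized uncoded placement: the caches of different terminals are independent, and each
cache is a uniformly random set of popular contents of the given size. -/
def placements (n : ℕ) (P : Finset ℕ) (M : ℕ) : Finset (Fin n → Finset ℕ) :=
  Fintype.piFinset fun _ => P.powersetCard (min M P.card)

/-! ### Geometry: the unit square, square-lets and routes -/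

/-- Squared Euclidean distance in the plane (the metric of `ℝ × ℝ` itself is the sup metric). -/
def sqDist (p q : ℝ × ℝ) : ℝ := (p.1 - q.1) ^ 2 + (p.2 - q.2) ^ 2

/-- The helper sits at the centre of the unit square. -/
def helper : ℝ × ℝ := (1 / 2, 1 / 2)

/-- The index of the square-let of side `1 / K` that contains the point `p`. -/
def cell (K : ℕ) (p : ℝ × ℝ) : ℤ × ℤ := (⌊(K : ℝ) * p.1⌋, ⌊(K : ℝ) * p.2⌋)

/-- The (closed) square-let with index `q`. -/
def squarelet (K : ℕ) (q : ℤ × ℤ) : Set (ℝ × ℝ) :=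
  {p | (q.1 : ℝ) ≤ K * p.1 ∧ K * p.1 ≤ q.1 + 1 ∧ (q.2 : ℝ) ≤ K * p.2 ∧ K * p.2 ≤ q.2 + 1}

/-- The number of horizontal and vertical steps between two square-lets. -/
def cellDist (a b : ℤ × ℤ) : ℤ := |a.1 - b.1| + |a.2 - b.2|

/-- `l` lists the terminals on a route between terminal `i` and the helper, beginning with `i`
itself; the helper comes after the last entry. The route has one terminal per square-let, it moves
by horizontal and vertical steps through square-lets that meet the straight line from `i` to the
helper, each step leading closer to the helper, and every hop (the one to the helper included) is
shorter than the transmission range `ρ`. -/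
structure IsRoute {n : ℕ} (K : ℕ) (ρ : ℝ) (Y : Fin n → ℝ × ℝ) (i : Fin n) (l : List (Fin n)) :
    Prop where
  head : l.head? = some i
  step : l.IsChain fun a b =>
    cellDist (cell K (Y a)) (cell K (Y b)) = 1 ∧
    cellDist (cell K (Y b)) (cell K helper) + 1 = cellDist (cell K (Y a)) (cell K helper) ∧
    sqDist (Y a) (Y b) < ρ ^ 2
  last : ∀ j ∈ l.getLast?,
    cellDist (cell K (Y j)) (cell K helper) ≤ 1 ∧ sqDist (Y j) helper < ρ ^ 2
  crosses : ∀ j ∈ l, (squarelet K (cell K (Y j)) ∩ segment ℝ (Y i) helper).Nonempty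

/-- `n` terminals placed independently and uniformly in the unit square. -/
def uniformPositions (n : ℕ) : Measure (Fin n → ℝ × ℝ) :=
  Measure.pi fun _ =>
    (volume : Measure (ℝ × ℝ)).restrict (Set.Icc (0 : ℝ) 1 ×ˢ Set.Icc (0 : ℝ) 1)

/-! ### Hops and throughput -/

/-- The number of hops that content `r` travels to the first terminal of the route `l`, when the
caches are `c`: the position on the route of the first terminal that stores `r` (`0` if the
requesting terminal stores it itself), and the number of hops to the helper, `l.length`, if no
terminal on the route stores `r`. -/
def hops {n : ℕ} (l : List (Fin n)) (c : Fin n → Finset ℕ) (r : ℕ) : ℕ :=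
  l.findIdx fun j => decide (r ∈ c j)

/-- `𝔼[x]`: the average number of hops traveled per request, over the requesting terminal (uniform),
the requested content (Zipf) and the cache placement (random decentralized uncoded caching of the
popular contents `ξ_{1-ε}`, with cache size `M`), when terminal `i` uses the route `route i`. -/
def averageHops {n : ℕ} (s : ℝ) (m M : ℕ) (ε : ℝ) (route : Fin n → List (Fin n)) : ℝ :=
  (∑ i : Fin n, ∑ r ∈ Finset.Icc 1 m, zipf s m r *
    ((∑ c ∈ placements n (popular s m ε) M, (hops (route i) c r : ℝ)) /
      (placements n (popular s m ε) M).card)) / n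

/-- The number of bits per unit of time that the network can carry over one hop: with square-lets
of side `C₁ ρ`, the square-lets at distance `C₂ = (2 + Δ) / C₁` square-lets from each other transmit
simultaneously without interference, so `1 / (C₂ C₁ ρ) ^ 2` of them are active in each time slot,
and each of them uses the bandwidth `W`. -/
def transportCapacity (W Δ C₁ ρ : ℝ) : ℝ :=
  W / ((2 + Δ) / C₁ * C₁ * ρ) ^ 2

/-- The network with terminals at `Y` sustains the data rate `lam` per terminal: every terminal has
a route to the helper, and for every choice of such routes the load `n * lam * 𝔼[x]` (in bit hops
per unit of time) does not exceed what the network can carry; that is,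
`lam ≤ W / (n * 𝔼[x] * (C₂ C₁ ρ) ^ 2)` whenever `𝔼[x] > 0`. The group of popular contents is the
one for `ε = 1 / √n`. -/
def SustainsRate {n : ℕ} (s : ℝ) (m M K : ℕ) (W Δ C₁ ρ : ℝ) (Y : Fin n → ℝ × ℝ) (lam : ℝ) : Prop :=
  (∃ route : Fin n → List (Fin n), ∀ i, IsRoute K ρ Y i (route i)) ∧
  ∀ route : Fin n → List (Fin n), (∀ i, IsRoute K ρ Y i (route i)) →
    n * lam * averageHops s m M (1 / √(n : ℝ)) route ≤ transportCapacity W Δ C₁ ρ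

end

end Femtocache

namespace Femtocache

/-! ### Existence of routes -/

/-! The proof combines a random-placement event with a bound on `averageHops` that holds for every
admissible route. Geometry: a square-let holds on average at least `a * log n` terminals with `a >
1`, so it is empty with probability at most `n ^ (-a)`. There are at most `n` square-lets, so with
probability tending to 1 none is empty. Then a route arises by following the segment to the helper
and picking a terminal in each square-let entered (`exists_isRoute`). Every admissible route has
distinct terminals, at most `2 * K + 1` of them, because the distance to the helper strictly
decreases. Hops: caches along a route are independent, and each contains a given popular content
with probability `min M h / h`, so the geometric waiting time has mean at most `h / M + 1`
(`sum_hops_le`). An unpopular request costs at most `2 * K + 1` hops but has probability at most `1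
/ √n`; since `K ≤ √n`, it contributes `O(1)` (`averageHops_le`). The Zipf tail gives `h = O(n ^ γ)`
with `γ = (α + 1/2) / s`, as the condition on `α` says that `γ > 1 / (2 * (s - 1))`
(`exists_popularCount_le`). Since `β ≤ γ`, the mean is `O(n ^ (γ - β))`, while the transport
capacity is at least of order `n / log n`. A small multiple of the claimed rate therefore fits, with
a factor `log n` to spare. -/

/-- Gives the time at which a linear motion reaches a wall, also when `e = 0`, that is, when both
end points already lie on that wall. -/
lemma exists_mul_eq_of_le {d e : ℝ} (hd : 0 ≤ d) (hde : d ≤ e) :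
    ∃ t ∈ Set.Icc (0 : ℝ) 1, t * e = d := by
  rcases eq_or_lt_of_le (hd.trans hde) with he | he
  · exact ⟨0, by simp, by linarith⟩
  · exact ⟨d / e, ⟨by positivity, (div_le_one he).2 hde⟩, div_mul_cancel₀ _ he.ne'⟩

/-- Moving from `x` in the unit interval `[q, q + 1]` towards `c` in a different unit interval
`[q₀, q₀ + 1]`, one enters an adjacent interval closer to the target. -/
lemma exists_coord_step {q q₀ : ℤ} (hq : q ≠ q₀) {x c : ℝ} (hx : x ∈ Set.Icc (q : ℝ) (q + 1))
    (hc : c ∈ Set.Icc (q₀ : ℝ) (q₀ + 1)) :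
    ∃ t ∈ Set.Icc (0 : ℝ) 1, ∃ q' : ℤ, |q - q'| = 1 ∧ |q' - q₀| + 1 = |q - q₀| ∧
      q ⊓ q₀ ≤ q' ∧ q' ≤ q ⊔ q₀ ∧ x + t * (c - x) ∈ Set.Icc (q' : ℝ) (q' + 1) ∧
      ∀ u ∈ Set.Icc 0 t, x + u * (c - x) ∈ Set.Icc (q : ℝ) (q + 1) := by
  obtain ⟨hx1, hx2⟩ := hx
  obtain ⟨hc1, hc2⟩ := hc
  rcases lt_or_gt_of_ne hq with h | h
  · have h' : (q : ℝ) + 1 ≤ q₀ := by exact_mod_cast h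
    -- `t` is the time of arrival at the wall `q + 1`; the intervals are closed, so the wall point
    -- already belongs to the next one.
    obtain ⟨t, ht, e⟩ := exists_mul_eq_of_le (d := q + 1 - x) (e := c - x) (by linarith)
      (by linarith)
    refine ⟨t, ht, q + 1, ?_, ?_, ?_, ?_, ?_, ?_⟩
    · simp
    · rw [abs_of_nonpos (by omega), abs_of_neg (by omega)]; omega
    · exact inf_le_left.trans (by omega)
    · exact le_trans (by omega) le_sup_right
    · rw [e]; push_cast; constructor <;> linarith
    · rintro u ⟨hu0, hut⟩
      have hcx : 0 ≤ c - x := by linarith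
      have h1 := mul_nonneg hu0 hcx
      have h2 := mul_le_mul_of_nonneg_right hut hcx
      constructor <;> linarith
  · have h' : (q₀ : ℝ) + 1 ≤ q := by exact_mod_cast h
    obtain ⟨t, ht, e⟩ := exists_mul_eq_of_le (d := x - q) (e := x - c) (by linarith)
      (by linarith)
    refine ⟨t, ht, q - 1, ?_, ?_, ?_, ?_, ?_, ?_⟩
    · simp
    · rw [abs_of_nonneg (by omega), abs_of_pos (by omega)]; omega
    · exact inf_le_right.trans (by omega)
    · exact le_trans (by omega) le_sup_left
    · have : x + t * (c - x) = q := by linear_combination -e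
      rw [this]; push_cast; constructor <;> linarith
    · rintro u ⟨hu0, hut⟩
      have hcx : 0 ≤ x - c := by linarith
      have h1 := mul_nonneg hu0 hcx
      have h2 := mul_le_mul_of_nonneg_right hut hcx
      constructor <;> linarith

lemma add_mul_sub_mem_Icc {a b x c u : ℝ} (hx : x ∈ Set.Icc a b) (hc : c ∈ Set.Icc a b)
    (hu : u ∈ Set.Icc (0 : ℝ) 1) : x + u * (c - x) ∈ Set.Icc a b := by
  simpa using (convex_Icc a b).add_smul_sub_mem hx hc hu

/-- The square-lets that meet a segment contain, with each square-let other than that of the end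
point, a neighbour closer to the end point. -/
lemma exists_adjacent_squarelet {K : ℕ} {p e : ℝ × ℝ} {q q₀ : ℤ × ℤ} (hne : q ≠ q₀)
    (hq : (squarelet K q ∩ segment ℝ p e).Nonempty) (he : e ∈ squarelet K q₀) :
    ∃ q', cellDist q q' = 1 ∧ cellDist q' q₀ + 1 = cellDist q q₀ ∧ q ⊓ q₀ ≤ q' ∧ q' ≤ q ⊔ q₀ ∧
      (squarelet K q' ∩ segment ℝ p e).Nonempty := by
  obtain ⟨z, ⟨hz1, hz2, hz3, hz4⟩, hz⟩ := hq
  obtain ⟨he1, he2, he3, he4⟩ := he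
  have key : ∀ t ∈ Set.Icc (0 : ℝ) 1, ∀ q' : ℤ × ℤ,
      K * z.1 + t * (K * e.1 - K * z.1) ∈ Set.Icc (q'.1 : ℝ) (q'.1 + 1) →
      K * z.2 + t * (K * e.2 - K * z.2) ∈ Set.Icc (q'.2 : ℝ) (q'.2 + 1) →
      (squarelet K q' ∩ segment ℝ p e).Nonempty := by
    rintro t ht q' ⟨h1, h2⟩ ⟨h3, h4⟩
    have e1 : K * (z + t • (e - z)).1 = K * z.1 + t * (K * e.1 - K * z.1) := by
      simp; ring
    have e2 : K * (z + t • (e - z)).2 = K * z.2 + t * (K * e.2 - K * z.2) := by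
      simp; ring
    refine ⟨z + t • (e - z), ⟨?_, ?_, ?_, ?_⟩,
      (convex_segment p e).add_smul_sub_mem hz (right_mem_segment ℝ p e) ht⟩
    · rwa [e1]
    · rwa [e1]
    · rwa [e2]
    · rwa [e2]
  obtain ⟨a, b⟩ := q
  obtain ⟨a₀, b₀⟩ := q₀
  simp only at hz1 hz2 hz3 hz4 he1 he2 he3 he4
  have useFirst : ∀ t ∈ Set.Icc (0 : ℝ) 1, ∀ a' : ℤ, |a - a'| = 1 → |a' - a₀| + 1 = |a - a₀| →
      a ⊓ a₀ ≤ a' → a' ≤ a ⊔ a₀ →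
      K * z.1 + t * (K * e.1 - K * z.1) ∈ Set.Icc (a' : ℝ) (a' + 1) →
      K * z.2 + t * (K * e.2 - K * z.2) ∈ Set.Icc (b : ℝ) (b + 1) →
      ∃ q', cellDist (a, b) q' = 1 ∧ cellDist q' (a₀, b₀) + 1 = cellDist (a, b) (a₀, b₀) ∧
        (a, b) ⊓ (a₀, b₀) ≤ q' ∧ q' ≤ (a, b) ⊔ (a₀, b₀) ∧
        (squarelet K q' ∩ segment ℝ p e).Nonempty := by
    intro t ht a' h1 h2 h3 h4 h5 h6
    exact ⟨(a', b), by simp [cellDist, h1], by simp only [cellDist]; omega,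
      ⟨h3, inf_le_left⟩, ⟨h4, le_sup_left⟩, key t ht (a', b) h5 h6⟩
  have useSecond : ∀ t ∈ Set.Icc (0 : ℝ) 1, ∀ b' : ℤ, |b - b'| = 1 → |b' - b₀| + 1 = |b - b₀| →
      b ⊓ b₀ ≤ b' → b' ≤ b ⊔ b₀ →
      K * z.1 + t * (K * e.1 - K * z.1) ∈ Set.Icc (a : ℝ) (a + 1) →
      K * z.2 + t * (K * e.2 - K * z.2) ∈ Set.Icc (b' : ℝ) (b' + 1) →
      ∃ q', cellDist (a, b) q' = 1 ∧ cellDist q' (a₀, b₀) + 1 = cellDist (a, b) (a₀, b₀) ∧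
        (a, b) ⊓ (a₀, b₀) ≤ q' ∧ q' ≤ (a, b) ⊔ (a₀, b₀) ∧
        (squarelet K q' ∩ segment ℝ p e).Nonempty := by
    intro t ht b' h1 h2 h3 h4 h5 h6
    exact ⟨(a, b'), by simp [cellDist, h1], by simp only [cellDist]; omega,
      ⟨inf_le_left, h3⟩, ⟨le_sup_left, h4⟩, key t ht (a, b') h5 h6⟩
  by_cases hab : a = a₀
  · subst hab
    have hb : b ≠ b₀ := fun h => hne (by rw [h])
    obtain ⟨t, ht, b', h1, h2, h3, h4, h5, -⟩ := exists_coord_step hb ⟨hz3, hz4⟩ ⟨he3, he4⟩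
    exact useSecond t ht b' h1 h2 h3 h4 (add_mul_sub_mem_Icc ⟨hz1, hz2⟩ ⟨he1, he2⟩ ht) h5
  obtain ⟨t, ht, a', h1, h2, h3, h4, h5, h6⟩ := exists_coord_step hab ⟨hz1, hz2⟩ ⟨he1, he2⟩
  by_cases hbb : b = b₀
  · subst hbb
    exact useFirst t ht a' h1 h2 h3 h4 h5 (add_mul_sub_mem_Icc ⟨hz3, hz4⟩ ⟨he3, he4⟩ ht)
  obtain ⟨u, hu, b', g1, g2, g3, g4, g5, g6⟩ := exists_coord_step hbb ⟨hz3, hz4⟩ ⟨he3, he4⟩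
  -- Cross the wall that is reached first; until then the other coordinate has not left its
  -- interval.
  rcases le_total t u with htu | htu
  · exact useFirst t ht a' h1 h2 h3 h4 h5 (g6 t ⟨ht.1, htu⟩)
  · exact useSecond u hu b' g1 g2 g3 g4 (h6 u ⟨hu.1, htu⟩) g5

lemma mem_squarelet_cell (K : ℕ) (p : ℝ × ℝ) : p ∈ squarelet K (cell K p) :=
  ⟨Int.floor_le _, (Int.lt_floor_add_one _).le, Int.floor_le _, (Int.lt_floor_add_one _).le⟩

lemma cellDist_nonneg (a b : ℤ × ℤ) : 0 ≤ cellDist a b := by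
  unfold cellDist; positivity

/-- Points in the same square-let or in neighbouring ones are within range. -/
lemma sqDist_lt_of_cellDist_le_one {K : ℕ} {ρ : ℝ} (hρ : 5 < (K * ρ) ^ 2) {p q : ℝ × ℝ}
    (h : cellDist (cell K p) (cell K q) ≤ 1) : sqDist p q < ρ ^ 2 := by
  have hK : (0 : ℝ) < (K : ℝ) ^ 2 := by
    rcases Nat.eq_zero_or_pos K with rfl | hK
    · norm_num at hρ
    · positivity
  have main : ∀ x y : ℝ, ∀ d : ℕ, |⌊x⌋ - ⌊y⌋| ≤ d → (x - y) ^ 2 ≤ ((d : ℝ) + 1) ^ 2 := by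
    intro x y d hd
    have hd' : |(⌊x⌋ : ℝ) - ⌊y⌋| ≤ d := by exact_mod_cast hd
    rw [abs_le] at hd'
    have h1 := Int.floor_le x
    have h2 := Int.lt_floor_add_one x
    have h3 := Int.floor_le y
    have h4 := Int.lt_floor_add_one y
    refine sq_le_sq' ?_ ?_ <;> linarith
  have bound : (K * p.1 - K * q.1) ^ 2 + (K * p.2 - K * q.2) ^ 2 ≤ 5 := by
    simp only [cellDist, cell] at h
    have h1 := abs_nonneg (⌊(K : ℝ) * p.1⌋ - ⌊(K : ℝ) * q.1⌋)
    have h2 := abs_nonneg (⌊(K : ℝ) * p.2⌋ - ⌊(K : ℝ) * q.2⌋)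
    -- One index agrees and the other differs by at most 1, so the scaled offsets are at most 1 and
    -- 2, whence `5 = 1 ^ 2 + 2 ^ 2`.
    rcases (show |⌊(K : ℝ) * p.1⌋ - ⌊(K : ℝ) * q.1⌋| ≤ 0 ∨
        |⌊(K : ℝ) * p.2⌋ - ⌊(K : ℝ) * q.2⌋| ≤ 0 by omega) with h0 | h0
    · have g1 := main _ _ 0 h0
      have g2 := main (K * p.2) (K * q.2) 1 (by push_cast; omega)
      push_cast at g1 g2; linarith
    · have g1 := main _ _ 0 h0
      have g2 := main (K * p.1) (K * q.1) 1 (by push_cast; omega)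
      push_cast at g1 g2; linarith
  have : (K : ℝ) ^ 2 * sqDist p q < (K : ℝ) ^ 2 * ρ ^ 2 := by
    unfold sqDist; nlinarith
  exact lt_of_mul_lt_mul_left this hK.le

/-- The indices of the square-lets in the unit square. -/
noncomputable def grid (K : ℕ) : Finset (ℤ × ℤ) := Finset.Ico 0 (K : ℤ) ×ˢ Finset.Ico 0 (K : ℤ)

lemma mem_grid {K : ℕ} {q : ℤ × ℤ} :
    q ∈ grid K ↔ (0 ≤ q.1 ∧ q.1 < K) ∧ 0 ≤ q.2 ∧ q.2 < K := by
  simp [grid]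

lemma card_grid (K : ℕ) : (grid K).card = K ^ 2 := by
  simp [grid, sq]

/-- Keeps the next square-let of a route inside the unit square, where occupancy supplies a
terminal. -/
lemma mem_grid_of_mem_Icc {K : ℕ} {q q₀ q' : ℤ × ℤ} (hq : q ∈ grid K) (hq₀ : q₀ ∈ grid K)
    (h1 : q ⊓ q₀ ≤ q') (h2 : q' ≤ q ⊔ q₀) : q' ∈ grid K := by
  rw [mem_grid] at *
  have a1 : min q.1 q₀.1 ≤ q'.1 := h1.1
  have a2 : min q.2 q₀.2 ≤ q'.2 := h1.2
  have a3 : q'.1 ≤ max q.1 q₀.1 := h2.1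
  have a4 : q'.2 ≤ max q.2 q₀.2 := h2.2
  omega

lemma cell_mem_grid {K : ℕ} (hK : 0 < K) {p : ℝ × ℝ}
    (hp : p ∈ Set.Ico (0 : ℝ) 1 ×ˢ Set.Ico (0 : ℝ) 1) : cell K p ∈ grid K := by
  obtain ⟨⟨h1, h2⟩, h3, h4⟩ := hp
  have hK' : (0 : ℝ) < K := by exact_mod_cast hK
  rw [mem_grid]
  refine ⟨⟨Int.floor_nonneg.2 (by positivity), Int.floor_lt.2 ?_⟩,
    Int.floor_nonneg.2 (by positivity), Int.floor_lt.2 ?_⟩ <;> push_cast <;> nlinarith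

lemma cell_helper_mem_grid {K : ℕ} (hK : 0 < K) : cell K helper ∈ grid K :=
  cell_mem_grid hK (by simp only [helper, Set.mem_prod, Set.mem_Ico]; norm_num)

/-- If every square-let contains a terminal, then every terminal has a route to the helper. -/
lemma exists_isRoute {n K : ℕ} {ρ : ℝ} {Y : Fin n → ℝ × ℝ} (hK : 0 < K)
    (hρ : 5 < (K * ρ) ^ 2) (hocc : ∀ q ∈ grid K, ∃ j, cell K (Y j) = q) (i : Fin n)
    (hi : cell K (Y i) ∈ grid K) : ∃ l, IsRoute K ρ Y i l := by
  -- Induction on the distance to the helper's square-let. The segment stays the one from `i` while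
  -- the current terminal `j` varies.
  have main : ∀ d : ℕ, ∀ j, cellDist (cell K (Y j)) (cell K helper) = d →
      cell K (Y j) ∈ grid K →
      (squarelet K (cell K (Y j)) ∩ segment ℝ (Y i) helper).Nonempty →
      ∃ l : List (Fin n), l.head? = some j ∧
        (l.IsChain fun a b => cellDist (cell K (Y a)) (cell K (Y b)) = 1 ∧
          cellDist (cell K (Y b)) (cell K helper) + 1 = cellDist (cell K (Y a)) (cell K helper) ∧
          sqDist (Y a) (Y b) < ρ ^ 2) ∧
        (∀ k ∈ l.getLast?,
          cellDist (cell K (Y k)) (cell K helper) ≤ 1 ∧ sqDist (Y k) helper < ρ ^ 2) ∧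
        ∀ k ∈ l, (squarelet K (cell K (Y k)) ∩ segment ℝ (Y i) helper).Nonempty := by
    intro d
    induction d with
    | zero =>
      intro j hj _ hseg
      have hj' : cellDist (cell K (Y j)) (cell K helper) ≤ 1 := by rw [hj]; norm_num
      refine ⟨[j], rfl, List.isChain_singleton _, ?_, by simpa using hseg⟩
      simpa using ⟨hj', sqDist_lt_of_cellDist_le_one hρ hj'⟩
    | succ d ih =>
      intro j hj hgrid hseg
      have hne : cell K (Y j) ≠ cell K helper := by
        intro h
        rw [h] at hj
        simp [cellDist] at hj
        omega
      obtain ⟨q', h1, h2, h3, h4, h5⟩ :=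
        exists_adjacent_squarelet hne hseg (mem_squarelet_cell K helper)
      have hq' := mem_grid_of_mem_Icc hgrid (cell_helper_mem_grid hK) h3 h4
      obtain ⟨k, rfl⟩ := hocc q' hq'
      obtain ⟨l, hl1, hl2, hl3, hl4⟩ := ih k (by rw [hj] at h2; push_cast at h2; omega) hq' h5
      obtain ⟨l, rfl⟩ : ∃ l', l = k :: l' := by
        cases l with
        | nil => simp at hl1
        | cons b l => simp at hl1; exact ⟨l, by rw [hl1]⟩
      refine ⟨j :: k :: l, rfl, ?_, ?_, ?_⟩
      · exact List.isChain_cons_cons.2 ⟨⟨h1, h2, sqDist_lt_of_cellDist_le_one hρ h1.le⟩, hl2⟩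
      · rwa [List.getLast?_cons_cons]
      · rw [List.forall_mem_cons]
        exact ⟨hseg, hl4⟩
  obtain ⟨l, h1, h2, h3, h4⟩ := main (cellDist (cell K (Y i)) (cell K helper)).toNat i
    (Int.toNat_of_nonneg (cellDist_nonneg _ _)).symm hi
    ⟨Y i, mem_squarelet_cell K _, left_mem_segment ℝ _ _⟩
  exact ⟨l, h1, h2, h3, h4⟩

/-! ### Routes are short -/

/-- Each step lowers the distance by one, and transitivity does the rest. This monotonicity yields
both the distinctness of the terminals and the length bound. -/
lemma IsRoute.pairwise {n K : ℕ} {ρ : ℝ} {Y : Fin n → ℝ × ℝ} {i : Fin n} {l : List (Fin n)}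
    (h : IsRoute K ρ Y i l) : (l.map fun j => cellDist (cell K (Y j)) (cell K helper)).Pairwise
      (· > ·) := by
  rw [← List.isChain_iff_pairwise, List.isChain_map]
  exact h.step.imp fun a b hab => by omega

lemma IsRoute.nodup {n K : ℕ} {ρ : ℝ} {Y : Fin n → ℝ × ℝ} {i : Fin n} {l : List (Fin n)}
    (h : IsRoute K ρ Y i l) : l.Nodup :=
  List.Nodup.of_map _ (h.pairwise.imp fun hab => ne_of_gt hab)

/-- The distances along the route are distinct integers in `[0, 2 * K]`. -/
lemma IsRoute.length_le {n K : ℕ} {ρ : ℝ} {Y : Fin n → ℝ × ℝ} {i : Fin n} {l : List (Fin n)}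
    (h : IsRoute K ρ Y i l) (hK : 0 < K) (hY : ∀ j, cell K (Y j) ∈ grid K) :
    l.length ≤ 2 * K + 1 := by
  have hnd : (l.map fun j => cellDist (cell K (Y j)) (cell K helper)).Nodup :=
    h.pairwise.imp fun hab => ne_of_gt hab
  have hsub : (l.map fun j => cellDist (cell K (Y j)) (cell K helper)).toFinset ⊆
      Finset.Icc (0 : ℤ) (2 * K) := by
    intro x hx
    simp only [List.mem_toFinset, List.mem_map] at hx
    obtain ⟨j, -, rfl⟩ := hx
    have h1 := mem_grid.1 (hY j)
    have h2 := mem_grid.1 (cell_helper_mem_grid hK)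
    rw [Finset.mem_Icc]
    refine ⟨cellDist_nonneg _ _, ?_⟩
    have h3 : |(cell K (Y j)).1 - (cell K helper).1| ≤ K := abs_le.2 ⟨by omega, by omega⟩
    have h4 : |(cell K (Y j)).2 - (cell K helper).2| ≤ K := abs_le.2 ⟨by omega, by omega⟩
    unfold cellDist
    omega
  have hcard := Finset.card_le_card hsub
  rw [List.toFinset_card_of_nodup hnd, List.length_map, Int.card_Icc] at hcard
  omega

end Femtocache

namespace Femtocache

/-! ### The expected number of hops -/

/-- The number of placements in which no terminal of a set `T` stores a given popular content. -/
lemma card_filter_placements {n : ℕ} {P : Finset ℕ} {M r : ℕ} (hr : r ∈ P) (T : Finset (Fin n)) :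
    (((placements n P M).filter fun c => ∀ j ∈ T, r ∉ c j).card : ℝ) =
      (1 - (min M P.card : ℕ) / (P.card : ℝ)) ^ T.card * (placements n P M).card := by
  classical
  set k := min M P.card with hk
  have hkP : k ≤ P.card := min_le_right _ _
  have hP : 0 < P.card := Finset.card_pos.2 ⟨r, hr⟩
  -- Independence of the caches: the event is again a product set, with `r` removed from the library
  -- of each terminal in `T`.
  have heq : ((placements n P M).filter fun c => ∀ j ∈ T, r ∉ c j) =
      Fintype.piFinset fun j => if j ∈ T then (P.erase r).powersetCard k else P.powersetCard k := by
    ext c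
    simp only [placements, Finset.mem_filter, Fintype.mem_piFinset, Finset.mem_powersetCard, ← hk]
    constructor
    · rintro ⟨h1, h2⟩ j
      split_ifs with hj
      · exact Finset.mem_powersetCard.2 ⟨Finset.subset_erase.2 ⟨(h1 j).1, h2 j hj⟩, (h1 j).2⟩
      · exact Finset.mem_powersetCard.2 (h1 j)
    · intro h
      refine ⟨fun j => ?_, fun j hj => ?_⟩
      · have := h j
        split_ifs at this
        · rw [Finset.mem_powersetCard] at this
          exact ⟨(Finset.subset_erase.1 this.1).1, this.2⟩
        · exact Finset.mem_powersetCard.1 this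
      · have := h j
        rw [if_pos hj, Finset.mem_powersetCard] at this
        exact (Finset.subset_erase.1 this.1).2
  -- The probability that a uniform `k`-subset of `P` avoids `r` is `1 - k / |P|`.
  have hchoose : ((P.card - 1).choose k : ℝ) = (1 - k / (P.card : ℝ)) * P.card.choose k := by
    have h := Nat.choose_mul_succ_eq (P.card - 1) k
    rw [Nat.sub_add_cancel hP] at h
    have h' : ((P.card - 1).choose k : ℝ) * P.card = P.card.choose k * (P.card - k) := by
      rw [← Nat.cast_sub hkP]; exact_mod_cast h
    field_simp
    linarith
  rw [heq, placements, Fintype.card_piFinset, Fintype.card_piFinset]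
  push_cast
  have : ∀ j : Fin n, (((if j ∈ T then (P.erase r).powersetCard k else P.powersetCard k).card : ℕ) : ℝ)
      = (if j ∈ T then (1 - k / (P.card : ℝ)) else 1) * (P.powersetCard k).card := by
    intro j
    split_ifs
    · rw [Finset.card_powersetCard, Finset.card_powersetCard, Finset.card_erase_of_mem hr, hchoose]
    · simp
  rw [Finset.prod_congr rfl fun j _ => this j, Finset.prod_mul_distrib]
  congr 1
  rw [Finset.prod_ite_mem, Finset.univ_inter, Finset.prod_const]

lemma hops_le_length {n : ℕ} (l : List (Fin n)) (c : Fin n → Finset ℕ) (r : ℕ) :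
    hops l c r ≤ l.length :=
  List.findIdx_le_length

/-- Tail-sum formula for a waiting time: a content travels more than `k` hops only if the first `k +
1` terminals all lack it. -/
lemma hops_le_sum {n : ℕ} (l : List (Fin n)) (c : Fin n → Finset ℕ) (r : ℕ) :
    hops l c r ≤ ∑ k ∈ Finset.range l.length,
      if ∀ j ∈ (l.take (k + 1)).toFinset, r ∉ c j then 1 else 0 := by
  rw [← Finset.card_filter]
  calc hops l c r = (Finset.range (hops l c r)).card := (Finset.card_range _).symm
    _ ≤ _ := by
      refine Finset.card_le_card fun k hk => ?_
      rw [Finset.mem_range] at hk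
      rw [Finset.mem_filter, Finset.mem_range]
      refine ⟨hk.trans_le (hops_le_length l c r), fun j hj => ?_⟩
      rw [List.mem_toFinset, List.mem_take_iff_getElem] at hj
      obtain ⟨i, hi, rfl⟩ := hj
      have := List.not_of_lt_findIdx (p := fun j => decide (r ∈ c j)) (xs := l) (i := i)
        (lt_of_le_of_lt (by omega) hk)
      simpa using this

/-- A popular content is found after `|P| / M` hops on average. -/
lemma sum_hops_le {n : ℕ} {P : Finset ℕ} {M r : ℕ} (hr : r ∈ P) (hM : 0 < M) {l : List (Fin n)}
    (hl : l.Nodup) :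
    ∑ c ∈ placements n P M, (hops l c r : ℝ) ≤
      (P.card : ℝ) / (min M P.card : ℕ) * (placements n P M).card := by
  have hP : 0 < P.card := Finset.card_pos.2 ⟨r, hr⟩
  have hk : 0 < min M P.card := lt_min hM hP
  have hkP : min M P.card ≤ P.card := min_le_right _ _
  set k := min M P.card with hkdef
  set x : ℝ := 1 - k / (P.card : ℝ) with hx
  have hP' : (0 : ℝ) < P.card := by exact_mod_cast hP
  have hk' : (0 : ℝ) < k := by exact_mod_cast hk
  have hkP' : (k : ℝ) ≤ P.card := by exact_mod_cast hkP
  have hx0 : 0 ≤ x := by rw [hx, sub_nonneg]; exact (div_le_one hP').2 hkP'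
  have hx1 : x < 1 := by rw [hx]; have : 0 < (k : ℝ) / P.card := by positivity
                         linarith
  have hgeom : ∑ i ∈ Finset.range l.length, x ^ (i + 1) ≤ (P.card : ℝ) / k := by
    calc ∑ i ∈ Finset.range l.length, x ^ (i + 1) ≤ ∑ i ∈ Finset.range l.length, x ^ i :=
          Finset.sum_le_sum fun i _ => pow_le_pow_of_le_one hx0 hx1.le (Nat.le_succ i)
      _ ≤ ∑' i, x ^ i :=
          (summable_geometric_of_lt_one hx0 hx1).sum_le_tsum _ fun i _ => pow_nonneg hx0 i
      _ = (P.card : ℝ) / k := by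
          rw [tsum_geometric_of_lt_one hx0 hx1, hx, sub_sub_cancel, inv_div]
  calc ∑ c ∈ placements n P M, (hops l c r : ℝ)
      ≤ ∑ c ∈ placements n P M, ∑ i ∈ Finset.range l.length,
          if ∀ j ∈ (l.take (i + 1)).toFinset, r ∉ c j then (1 : ℝ) else 0 := by
        refine Finset.sum_le_sum fun c _ => ?_
        exact_mod_cast hops_le_sum l c r
    _ = ∑ i ∈ Finset.range l.length, x ^ (i + 1) * (placements n P M).card := by
        rw [Finset.sum_comm]
        refine Finset.sum_congr rfl fun i hi => ?_
        -- Since the route has no repetitions, its first `i + 1` entries are `i + 1` independent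
        -- caches.
        rw [Finset.sum_boole, card_filter_placements hr,
          List.toFinset_card_of_nodup (hl.sublist (List.take_sublist _ _)), List.length_take,
          min_eq_left (Nat.succ_le_of_lt (Finset.mem_range.1 hi))]
    _ ≤ _ := by
        rw [← Finset.sum_mul]
        exact mul_le_mul_of_nonneg_right hgeom (Nat.cast_nonneg _)

/-! ### Zipf's law -/

lemma one_le_sum_rpow (s : ℝ) {m : ℕ} (hm : 0 < m) :
    1 ≤ ∑ j ∈ Finset.Icc 1 m, (j : ℝ) ^ (-s) := by
  have h := Finset.single_le_sum (f := fun j : ℕ => (j : ℝ) ^ (-s)) (s := Finset.Icc 1 m)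
    (fun j _ => by positivity) (Finset.mem_Icc.2 ⟨le_rfl, hm⟩)
  simpa using h

lemma zipf_nonneg (s : ℝ) (m r : ℕ) : 0 ≤ zipf s m r := by
  unfold zipf; positivity

lemma sum_zipf (s : ℝ) {m : ℕ} (hm : 0 < m) : ∑ r ∈ Finset.Icc 1 m, zipf s m r = 1 := by
  simp only [zipf]
  rw [← Finset.sum_div, div_self]
  exact (zero_lt_one.trans_le (one_le_sum_rpow s hm)).ne'

lemma sum_zipf_add (s : ℝ) {h m : ℕ} (hm : 0 < m) (hhm : h ≤ m) :
    ∑ r ∈ Finset.Icc 1 h, zipf s m r + ∑ r ∈ Finset.Ioc h m, zipf s m r = 1 := by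
  rw [← sum_zipf s hm, ← Finset.sum_union]
  · congr 1
    ext r
    simp only [Finset.mem_union, Finset.mem_Icc, Finset.mem_Ioc]
    omega
  · rw [Finset.disjoint_left]
    intro r h1 h2
    rw [Finset.mem_Icc] at h1
    rw [Finset.mem_Ioc] at h2
    omega

lemma popularCount_spec (s : ℝ) {m : ℕ} (hm : 0 < m) {ε : ℝ} (hε : 0 ≤ ε) :
    popularCount s m ε ≤ m ∧
      1 - ε ≤ ∑ r ∈ Finset.Icc 1 (popularCount s m ε), zipf s m r :=
  Nat.sInf_mem (s := {h : ℕ | h ≤ m ∧ 1 - ε ≤ ∑ r ∈ Finset.Icc 1 h, zipf s m r})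
    ⟨m, le_rfl, by rw [sum_zipf s hm]; linarith⟩

lemma sum_zipf_unpopular_le (s : ℝ) {m : ℕ} (hm : 0 < m) {ε : ℝ} (hε : 0 ≤ ε) :
    ∑ r ∈ Finset.Ioc (popularCount s m ε) m, zipf s m r ≤ ε := by
  obtain ⟨h1, h2⟩ := popularCount_spec s hm hε
  linarith [sum_zipf_add s hm h1]

/-- Split `r ^ (-s)` as `r ^ (-δ) * r ^ (-(s - δ))`: the first factor is at most `h ^ (-δ)` and the
second is summable. This is cruder than the integral bound, but any `δ < s - 1` is allowed. -/
lemma sum_Ioc_rpow_le {s δ : ℝ} (hδ : 0 ≤ δ) (hs : 1 < s - δ) {h : ℕ} (hh : 0 < h) (m : ℕ) :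
    ∑ r ∈ Finset.Ioc h m, (r : ℝ) ^ (-s) ≤ (h : ℝ) ^ (-δ) * ∑' r : ℕ, (r : ℝ) ^ (-(s - δ)) := by
  have hsum : Summable fun r : ℕ => (r : ℝ) ^ (-(s - δ)) :=
    Real.summable_nat_rpow.2 (by linarith)
  calc ∑ r ∈ Finset.Ioc h m, (r : ℝ) ^ (-s)
      ≤ ∑ r ∈ Finset.Ioc h m, (h : ℝ) ^ (-δ) * (r : ℝ) ^ (-(s - δ)) := by
        refine Finset.sum_le_sum fun r hr => ?_
        rw [Finset.mem_Ioc] at hr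
        have hh' : (0 : ℝ) < h := by exact_mod_cast hh
        have hhr : (h : ℝ) ≤ r := by exact_mod_cast hr.1.le
        have hr' : (0 : ℝ) < r := hh'.trans_le hhr
        rw [show -s = -δ + -(s - δ) by ring, Real.rpow_add hr']
        exact mul_le_mul_of_nonneg_right
          (Real.rpow_le_rpow_of_nonpos hh' hhr (by linarith)) (by positivity)
    _ ≤ _ := by
        rw [← Finset.mul_sum]
        exact mul_le_mul_of_nonneg_left (hsum.sum_le_tsum _ fun r _ => by positivity)
          (by positivity)

/-- Up to constants there are at most `n ^ γ` popular contents when `2 * γ * (s - 1) > 1`. -/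
lemma exists_popularCount_le {s γ : ℝ} (hγ : 0 < γ) (hsγ : 1 / (2 * γ) < s - 1) :
    ∃ B : ℝ, 0 < B ∧ ∀ n m : ℕ, 0 < n → 0 < m →
      (popularCount s m (1 / √(n : ℝ)) : ℝ) ≤ B * (n : ℝ) ^ γ := by
  -- Chosen so that `(n ^ γ) ^ (-δ) = 1 / √n`.
  set δ := 1 / (2 * γ) with hδ
  have hδ0 : 0 < δ := by positivity
  set Z := ∑' r : ℕ, (r : ℝ) ^ (-(s - δ)) with hZ
  have hZ0 : 0 ≤ Z := tsum_nonneg fun r => by positivity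
  refine ⟨(Z + 1) ^ (2 * γ) + 1, by positivity, fun n m hn hm => ?_⟩
  have hn' : (1 : ℝ) ≤ n := by exact_mod_cast hn
  have hn0 : (0 : ℝ) < n := by linarith
  -- Solves `t ^ (-δ) * (Z + 1) = 1 / √n`. The extra `+ 1` in the constant `B` absorbs the rounding
  -- up of `t`.
  set t : ℝ := (Z + 1) ^ (2 * γ) * (n : ℝ) ^ γ with ht
  have ht0 : 0 < t := by positivity
  have hN : 0 < ⌈t⌉₊ := Nat.ceil_pos.2 ht0
  have hle : popularCount s m (1 / √(n : ℝ)) ≤ ⌈t⌉₊ := by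
    rcases le_total m ⌈t⌉₊ with hm' | hm'
    · exact (popularCount_spec s hm (by positivity)).1.trans hm'
    · refine Nat.sInf_le ⟨hm', ?_⟩
      have h1 := sum_zipf_add s hm hm'
      suffices h : ∑ r ∈ Finset.Ioc ⌈t⌉₊ m, zipf s m r ≤ 1 / √(n : ℝ) by linarith
      have hH := one_le_sum_rpow s hm
      have htδ : t ^ (-δ) = (Z + 1)⁻¹ * (1 / √(n : ℝ)) := by
        have e1 : 2 * γ * -δ = -1 := by rw [hδ]; field_simp
        have e2 : γ * -δ = -(1 / 2) := by rw [hδ]; field_simp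
        rw [ht, Real.mul_rpow (by positivity) (by positivity), ← Real.rpow_mul (by positivity),
          ← Real.rpow_mul (by positivity), e1, e2, Real.rpow_neg_one, Real.rpow_neg hn0.le,
          Real.sqrt_eq_rpow, one_div ((n : ℝ) ^ (1 / 2 : ℝ))]
      calc ∑ r ∈ Finset.Ioc ⌈t⌉₊ m, zipf s m r ≤ ∑ r ∈ Finset.Ioc ⌈t⌉₊ m, (r : ℝ) ^ (-s) :=
            Finset.sum_le_sum fun r _ => div_le_self (by positivity) hH
        _ ≤ (⌈t⌉₊ : ℝ) ^ (-δ) * Z := sum_Ioc_rpow_le hδ0.le (by linarith) hN m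
        _ ≤ t ^ (-δ) * (Z + 1) := by
            refine mul_le_mul ?_ (by linarith) hZ0 (by positivity)
            exact Real.rpow_le_rpow_of_nonpos ht0 (Nat.le_ceil t) (by linarith)
        _ = 1 / √(n : ℝ) := by
            rw [htδ]; field_simp
  have h1 : (1 : ℝ) ≤ (n : ℝ) ^ γ := Real.one_le_rpow hn' hγ.le
  calc (popularCount s m (1 / √(n : ℝ)) : ℝ) ≤ ⌈t⌉₊ := by exact_mod_cast hle
    _ ≤ t + 1 := (Nat.ceil_lt_add_one ht0.le).le
    _ ≤ _ := by rw [add_mul, ht]; linarith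

/-- The average number of hops, when the routes have at most `L` hops. -/
lemma averageHops_le {n : ℕ} (s : ℝ) {m M : ℕ} (hm : 0 < m) (hM : 0 < M) {ε : ℝ} (hε : 0 ≤ ε)
    {route : Fin n → List (Fin n)} (hnd : ∀ i, (route i).Nodup) {L : ℕ}
    (hL : ∀ i, (route i).length ≤ L) :
    averageHops s m M ε route ≤ ((popularCount s m ε : ℝ) / M + 1) + ε * L := by
  set h := popularCount s m ε with hh
  obtain ⟨hhm, -⟩ := popularCount_spec s hm hε
  have hcard : (popular s m ε).card = h := by simp [popular, hh]
  set D := placements n (popular s m ε) M with hD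
  have hM' : (0 : ℝ) < M := by exact_mod_cast hM
  have hDpos : 0 < (D.card : ℝ) := by
    rw [Nat.cast_pos, Finset.card_pos, hD, placements, Fintype.piFinset_nonempty]
    exact fun _ => Finset.powersetCard_nonempty.2 (min_le_right _ _)
  have hpop : ∀ i, ∀ r ∈ Finset.Icc 1 h,
      (∑ c ∈ D, (hops (route i) c r : ℝ)) / D.card ≤ (h : ℝ) / M + 1 := by
    intro i r hr
    have hr' : r ∈ popular s m ε := hr
    have h1 : 0 < h := by rw [Finset.mem_Icc] at hr; omega
    rw [div_le_iff₀ hDpos]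
    refine (sum_hops_le hr' hM (hnd i)).trans (mul_le_mul_of_nonneg_right ?_ hDpos.le)
    rw [hcard]
    -- If `M ≥ h`, every cache holds all popular contents and the ratio is 1; the summand `+ 1`
    -- covers this case.
    rcases le_total M h with hMh | hMh
    · rw [min_eq_left hMh]; linarith
    · rw [min_eq_right hMh, div_self (by positivity)]
      have : 0 ≤ (h : ℝ) / M := by positivity
      linarith
  have hunpop : ∀ i r, (∑ c ∈ D, (hops (route i) c r : ℝ)) / D.card ≤ L := by
    intro i r
    rw [div_le_iff₀ hDpos]
    calc ∑ c ∈ D, (hops (route i) c r : ℝ) ≤ ∑ c ∈ D, (L : ℝ) :=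
          Finset.sum_le_sum fun c _ => by
            exact_mod_cast (hops_le_length (route i) c r).trans (hL i)
      _ = L * D.card := by rw [Finset.sum_const, nsmul_eq_mul, mul_comm]
  have hterm : ∀ i, ∑ r ∈ Finset.Icc 1 m, zipf s m r *
      ((∑ c ∈ D, (hops (route i) c r : ℝ)) / D.card) ≤ ((h : ℝ) / M + 1) + ε * L := by
    intro i
    have hsplit : Finset.Icc 1 m = Finset.Icc 1 h ∪ Finset.Ioc h m := by
      ext r
      simp only [Finset.mem_union, Finset.mem_Icc, Finset.mem_Ioc]
      omega
    have hdisj : Disjoint (Finset.Icc 1 h) (Finset.Ioc h m) := by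
      rw [Finset.disjoint_left]
      intro r h1 h2
      rw [Finset.mem_Icc] at h1
      rw [Finset.mem_Ioc] at h2
      omega
    rw [hsplit, Finset.sum_union hdisj]
    refine add_le_add ?_ ?_
    · calc _ ≤ ∑ r ∈ Finset.Icc 1 h, zipf s m r * ((h : ℝ) / M + 1) :=
            Finset.sum_le_sum fun r hr =>
              mul_le_mul_of_nonneg_left (hpop i r hr) (zipf_nonneg s m r)
        _ ≤ 1 * ((h : ℝ) / M + 1) := by
            rw [← Finset.sum_mul]
            refine mul_le_mul_of_nonneg_right ?_ (by positivity)
            have h1 := sum_zipf_add s hm hhm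
            have h2 : 0 ≤ ∑ r ∈ Finset.Ioc h m, zipf s m r :=
              Finset.sum_nonneg fun r _ => zipf_nonneg s m r
            linarith
        _ = _ := one_mul _
    · calc _ ≤ ∑ r ∈ Finset.Ioc h m, zipf s m r * (L : ℝ) :=
            Finset.sum_le_sum fun r hr =>
              mul_le_mul_of_nonneg_left (hunpop i r) (zipf_nonneg s m r)
        _ ≤ ε * L := by
            rw [← Finset.sum_mul]
            exact mul_le_mul_of_nonneg_right (sum_zipf_unpopular_le s hm hε) (Nat.cast_nonneg _)
  unfold averageHops
  refine div_le_of_le_mul₀ (Nat.cast_nonneg _) (by positivity) ?_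
  calc _ ≤ ∑ i : Fin n, (((h : ℝ) / M + 1) + ε * L) := Finset.sum_le_sum fun i _ => hterm i
    _ = _ := by rw [Finset.sum_const, Finset.card_univ, Fintype.card_fin, nsmul_eq_mul, mul_comm]

end Femtocache

namespace Femtocache

/-! ### Every square-let is occupied with high probability -/

noncomputable def unitSquareMeasure : Measure (ℝ × ℝ) :=
  (volume : Measure (ℝ × ℝ)).restrict (Set.Icc (0 : ℝ) 1 ×ˢ Set.Icc (0 : ℝ) 1)

instance : IsProbabilityMeasure unitSquareMeasure := by
  constructor
  rw [unitSquareMeasure, Measure.restrict_apply_univ, Measure.volume_eq_prod, Measure.prod_prod,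
    Real.volume_Icc]
  simp

lemma uniformPositions_eq (n : ℕ) :
    uniformPositions n = Measure.pi fun _ : Fin n => unitSquareMeasure := rfl

/-- Points with a coordinate equal to 1 have a cell index outside `grid K`; they form a null set. -/
lemma unitSquareMeasure_compl :
    unitSquareMeasure (Set.Ico (0 : ℝ) 1 ×ˢ Set.Ico (0 : ℝ) 1)ᶜ = 0 := by
  rw [prob_compl_eq_zero_iff (measurableSet_Ico.prod measurableSet_Ico), unitSquareMeasure,
    Measure.restrict_apply (measurableSet_Ico.prod measurableSet_Ico),
    Set.inter_eq_left.2 (Set.prod_mono Set.Ico_subset_Icc_self Set.Ico_subset_Icc_self),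
    Measure.volume_eq_prod, Measure.prod_prod, Real.volume_Ico]
  simp

lemma preimage_cell {K : ℕ} (hK : 0 < K) (q : ℤ × ℤ) :
    cell K ⁻¹' {q} = Set.Ico ((q.1 : ℝ) / K) ((q.1 + 1) / K) ×ˢ
      Set.Ico ((q.2 : ℝ) / K) ((q.2 + 1) / K) := by
  have hK' : (0 : ℝ) < K := by exact_mod_cast hK
  ext p
  simp only [cell, Set.mem_preimage, Set.mem_singleton_iff, Prod.ext_iff, Int.floor_eq_iff,
    Set.mem_prod, Set.mem_Ico, div_le_iff₀ hK', lt_div_iff₀ hK', mul_comm (K : ℝ)]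

lemma unitSquareMeasure_preimage_cell {K : ℕ} (hK : 0 < K) {q : ℤ × ℤ} (hq : q ∈ grid K) :
    unitSquareMeasure (cell K ⁻¹' {q}) = ENNReal.ofReal (1 / (K : ℝ) ^ 2) := by
  have hK' : (0 : ℝ) < K := by exact_mod_cast hK
  obtain ⟨⟨h1, h2⟩, h3, h4⟩ := mem_grid.1 hq
  have side : ∀ z : ℤ, 0 ≤ z → z < K →
      Set.Ico ((z : ℝ) / K) ((z + 1) / K) ⊆ Set.Icc (0 : ℝ) 1 := by
    intro z hz0 hzK
    have a1 : (0 : ℝ) ≤ z := by exact_mod_cast hz0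
    have a2 : (z : ℝ) + 1 ≤ K := by exact_mod_cast hzK
    exact Set.Ico_subset_Icc_self.trans
      (Set.Icc_subset_Icc (by positivity) ((div_le_one hK').2 a2))
  rw [preimage_cell hK, unitSquareMeasure,
    Measure.restrict_apply (measurableSet_Ico.prod measurableSet_Ico),
    Set.inter_eq_left.2 (Set.prod_mono (side _ h1 h2) (side _ h3 h4)),
    Measure.volume_eq_prod, Measure.prod_prod, Real.volume_Ico, Real.volume_Ico,
    ← ENNReal.ofReal_mul (by rw [← sub_div]; simp)]
  congr 1
  field_simp
  ring

/-- By independence the probability is `(1 - 1 / K ^ 2) ^ n`. -/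
lemma uniformPositions_empty_cell_le {n K : ℕ} (hK : 0 < K) {q : ℤ × ℤ} (hq : q ∈ grid K) :
    uniformPositions n {Y | ∀ j, cell K (Y j) ≠ q} ≤
      ENNReal.ofReal (Real.exp (-(n / (K : ℝ) ^ 2))) := by
  have hset : {Y : Fin n → ℝ × ℝ | ∀ j, cell K (Y j) ≠ q} =
      Set.univ.pi fun _ => (cell K ⁻¹' {q})ᶜ := by
    ext Y; simp
  have hmeas : MeasurableSet (cell K ⁻¹' {q}) := by
    rw [preimage_cell hK]; exact measurableSet_Ico.prod measurableSet_Ico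
  have hK' : (1 : ℝ) ≤ (K : ℝ) ^ 2 := one_le_pow₀ (by exact_mod_cast hK)
  have hnonneg : 0 ≤ 1 - 1 / (K : ℝ) ^ 2 := sub_nonneg.2 ((div_le_one (by linarith)).2 hK')
  rw [uniformPositions_eq, hset, Measure.pi_pi, Finset.prod_const, Finset.card_univ,
    Fintype.card_fin, prob_compl_eq_one_sub hmeas, unitSquareMeasure_preimage_cell hK hq,
    ← ENNReal.ofReal_one, ← ENNReal.ofReal_sub _ (by positivity), ← ENNReal.ofReal_pow hnonneg]
  refine ENNReal.ofReal_le_ofReal ?_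
  calc (1 - 1 / (K : ℝ) ^ 2) ^ n ≤ Real.exp (-(1 / (K : ℝ) ^ 2)) ^ n :=
        pow_le_pow_left₀ hnonneg (Real.one_sub_le_exp_neg _) n
    _ = Real.exp (-(n / (K : ℝ) ^ 2)) := by
        rw [← Real.exp_nat_mul]; congr 1; ring

/-- The placements in the half-open unit square with a terminal in every square-let. -/
def occupied (n K : ℕ) : Set (Fin n → ℝ × ℝ) :=
  {Y | (∀ j, Y j ∈ Set.Ico (0 : ℝ) 1 ×ˢ Set.Ico (0 : ℝ) 1) ∧
    ∀ q ∈ grid K, ∃ j, cell K (Y j) = q}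

/-- Union bound over the `K ^ 2` square-lets, after discarding the null set of boundary placements.
-/
lemma uniformPositions_compl_occupied_le {n K : ℕ} (hK : 0 < K) :
    uniformPositions n (occupied n K)ᶜ ≤
      ENNReal.ofReal ((K : ℝ) ^ 2 * Real.exp (-(n / (K : ℝ) ^ 2))) := by
  have hsub : (occupied n K)ᶜ ⊆
      (⋃ j : Fin n, Function.eval j ⁻¹' (Set.Ico (0 : ℝ) 1 ×ˢ Set.Ico (0 : ℝ) 1)ᶜ) ∪
      ⋃ q ∈ grid K, {Y | ∀ j, cell K (Y j) ≠ q} := by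
    intro Y hY
    by_contra hcon
    simp only [Set.mem_union, Set.mem_iUnion, Set.mem_preimage, Set.mem_compl_iff, not_or,
      not_exists, not_not, Set.mem_ofPred_eq, not_forall] at hcon
    exact hY ⟨hcon.1, fun q hq => by simpa using hcon.2 q hq⟩
  have hnull : uniformPositions n
      (⋃ j : Fin n, Function.eval j ⁻¹' (Set.Ico (0 : ℝ) 1 ×ˢ Set.Ico (0 : ℝ) 1)ᶜ) = 0 := by
    rw [measure_iUnion_null_iff]
    intro j
    rw [uniformPositions_eq]
    exact (Measure.quasiMeasurePreserving_eval (fun _ : Fin n => unitSquareMeasure) j).preimage_null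
      unitSquareMeasure_compl
  calc uniformPositions n (occupied n K)ᶜ
      ≤ 0 + ∑ q ∈ grid K, uniformPositions n {Y | ∀ j, cell K (Y j) ≠ q} := by
        refine (measure_mono hsub).trans ((measure_union_le _ _).trans ?_)
        exact add_le_add hnull.le (measure_biUnion_finset_le _ _)
    _ ≤ 0 + ∑ q ∈ grid K, ENNReal.ofReal (Real.exp (-(n / (K : ℝ) ^ 2))) := by
        gcongr with q hq
        exact uniformPositions_empty_cell_le hK hq
    _ = _ := by
        rw [zero_add, Finset.sum_const, card_grid, nsmul_eq_mul,
          ENNReal.ofReal_mul (by positivity), ← Nat.cast_pow, ENNReal.ofReal_natCast]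

/-- If the square-lets contain on average at least `a * log n` terminals, `a > 1`, then with high
probability none of them is empty. -/
lemma tendsto_uniformPositions_compl_occupied {K : ℕ → ℕ} (hK : ∀ᶠ n in atTop, 0 < K n) {a : ℝ}
    (ha : 1 < a) (hKa : ∀ᶠ n : ℕ in atTop, a * Real.log n * (K n : ℝ) ^ 2 ≤ n) :
    Tendsto (fun n : ℕ => uniformPositions n (occupied n (K n))ᶜ) atTop (𝓝 0) := by
  have hlim : Tendsto (fun n : ℕ => ENNReal.ofReal ((n : ℝ) ^ (-(a - 1)))) atTop (𝓝 0) := by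
    rw [← ENNReal.ofReal_zero]
    exact ENNReal.tendsto_ofReal
      ((tendsto_rpow_neg_atTop (by linarith)).comp tendsto_natCast_atTop_atTop)
  refine tendsto_of_tendsto_of_tendsto_of_le_of_le' tendsto_const_nhds hlim
    (Eventually.of_forall fun _ => zero_le) ?_
  have hlog : ∀ᶠ n : ℕ in atTop, 1 ≤ Real.log n :=
    (Real.tendsto_log_atTop.comp tendsto_natCast_atTop_atTop).eventually_ge_atTop 1
  filter_upwards [hK, hKa, hlog, eventually_gt_atTop 0] with n hKn hKan hlogn hn
  refine (uniformPositions_compl_occupied_le hKn).trans (ENNReal.ofReal_le_ofReal ?_)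
  have hn' : (0 : ℝ) < n := by exact_mod_cast hn
  have hKn' : (0 : ℝ) < (K n : ℝ) ^ 2 := by positivity
  have h1 : (K n : ℝ) ^ 2 ≤ n := by
    refine le_trans ?_ hKan
    exact le_mul_of_one_le_left hKn'.le (one_le_mul_of_one_le_of_one_le ha.le hlogn)
  have h2 : Real.exp (-(n / (K n : ℝ) ^ 2)) ≤ (n : ℝ) ^ (-a) := by
    rw [Real.rpow_def_of_pos hn']
    refine Real.exp_le_exp.2 ?_
    have : a * Real.log n ≤ n / (K n : ℝ) ^ 2 := (le_div_iff₀ hKn').2 hKan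
    linarith
  calc (K n : ℝ) ^ 2 * Real.exp (-(n / (K n : ℝ) ^ 2)) ≤ n * (n : ℝ) ^ (-a) := by gcongr
    _ = (n : ℝ) ^ (-(a - 1)) := by
        rw [show -(a - 1) = 1 + -a by ring, Real.rpow_add hn', Real.rpow_one]

/-! ### Asymptotics of the parameters -/

/-- Makes `m` and `M` eventually positive and bounds `h / M` from above. -/
lemma eventually_half_mul_rpow_le {u : ℕ → ℕ} {C γ : ℝ} (hC : 0 < C)
    (hu : (fun n : ℕ => (u n : ℝ)) ~[atTop] fun n : ℕ => C * (n : ℝ) ^ γ) :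
    ∀ᶠ n : ℕ in atTop, C / 2 * (n : ℝ) ^ γ ≤ u n := by
  filter_upwards [hu.isLittleO.def (c := 1 / 2) (by norm_num)] with n hn
  have hpos : 0 ≤ C * (n : ℝ) ^ γ := by positivity
  simp only [Pi.sub_apply, Real.norm_eq_abs, abs_of_nonneg hpos] at hn
  linarith [(abs_le.1 hn).1]

/-- On an occupied placement the terminals sustain every rate allowed by the bound on the average
number of hops. -/
lemma sustainsRate_of_mem_occupied {n K : ℕ} {s : ℝ} {m M : ℕ} {W Δ C₁ ρ lam : ℝ}
    {Y : Fin n → ℝ × ℝ} (hY : Y ∈ occupied n K) (hK : 0 < K) (hρ : 5 < (K * ρ) ^ 2) (hm : 0 < m)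
    (hM : 0 < M) (hlam : 0 ≤ lam)
    (hload : n * lam * ((popularCount s m (1 / √(n : ℝ)) : ℝ) / M + 1 +
      1 / √(n : ℝ) * (2 * K + 1 : ℕ)) ≤ transportCapacity W Δ C₁ ρ) :
    SustainsRate s m M K W Δ C₁ ρ Y lam := by
  have hgrid : ∀ j, cell K (Y j) ∈ grid K := fun j => cell_mem_grid hK (hY.1 j)
  refine ⟨Classical.skolem.1 fun i => exists_isRoute hK hρ hY.2 i (hgrid i), fun route hr => ?_⟩
  refine le_trans (mul_le_mul_of_nonneg_left ?_ (by positivity)) hload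
  exact averageHops_le s hm hM (by positivity) (fun i => (hr i).nodup)
    fun i => (hr i).length_le hK hgrid

end Femtocache

/-! ### Calibration of the rate -/

theorem corollary1
    -- Zipf exponent, content and cache growth
    (s α β C₃ C₄ : ℝ) (hs : 1 < s) (hα : 1 / (2 * (s - 1)) < α)
    (hβ : β ≤ (α + 1 / 2) / s) (hC₃ : 0 < C₃) (hC₄ : 0 < C₄)
    (m M : ℕ → ℕ)
    (hm : (fun n : ℕ => (m n : ℝ)) ~[atTop] fun n : ℕ => C₃ * (n : ℝ) ^ α)
    (hM : (fun n : ℕ => (M n : ℝ)) ~[atTop] fun n : ℕ => C₄ * (n : ℝ) ^ β)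
    -- bandwidth, guard zone, and the constant relating square-lets and transmission range
    (W Δ C₁ : ℝ) (hW : 0 < W) (hΔ : 0 < Δ) (hC₁ : 0 < C₁) (hC₁' : √5 * C₁ < 1)
    -- transmission range `ρ n`, and `K n` square-lets of side `C₁ * ρ n` along each side
    (ρ : ℕ → ℝ) (K : ℕ → ℕ)
    (hρ : ρ =Θ[atTop] fun n : ℕ => √(Real.log n / n))
    (hK : ∀ᶠ n : ℕ in atTop, C₁ * ρ n * K n = 1)
    -- a square-let contains on average at least `a * log n` terminals, with `a > 1`
    (a : ℝ) (ha : 1 < a) (hKa : ∀ᶠ n : ℕ in atTop, a * Real.log n * (K n : ℝ) ^ 2 ≤ n) :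
    ∃ lam : ℕ → ℝ,
      (∀ᶠ n in atTop, 0 < lam n) ∧
      (lam =Θ[atTop] fun n : ℕ =>
        (n : ℝ) ^ (β - 1 / s * (α + 1 / 2)) * (1 / Real.log n ^ 2)) ∧
      Tendsto (fun n : ℕ => Femtocache.uniformPositions n
          {Y | ¬ Femtocache.SustainsRate s (m n) (M n) (K n) W Δ C₁ (ρ n) Y (lam n)})
        atTop (𝓝 0) := by
  set γ := (α + 1 / 2) / s with hγ
  have hs0 : 0 < s := by linarith
  have hs1 : 0 < s - 1 := by linarith
  have hα0 : 0 < α := lt_trans (by positivity) hα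
  have hγ0 : 0 < γ := by positivity
  -- Both this inequality and the condition on `α` amount to `s < (s - 1) * (2 * α + 1)`.
  have hsγ : 1 / (2 * γ) < s - 1 := by
    rw [div_lt_iff₀ (by positivity)] at hα ⊢
    rw [hγ]
    field_simp
    nlinarith
  have hexp : β - 1 / s * (α + 1 / 2) = β - γ := by rw [hγ]; ring
  rw [hexp]
  obtain ⟨B, hB, hpop⟩ := Femtocache.exists_popularCount_le hγ0 hsγ
  obtain ⟨C, hC, hρC⟩ := hρ.1.exists_pos
  rw [isBigOWith_iff] at hρC
  -- The three terms of the hop bound: `2 * B / C₄` from `h / M`, then `1`, then `3` from unpopular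
  -- requests.
  set D := 2 * B / C₄ + 4 with hD
  have hD0 : 0 < D := by positivity
  -- Makes `c * D * (n / log n)` equal to the lower bound on the transport capacity given by `|ρ n|
  -- ≤ C * √(log n / n)`.
  set c := W / ((2 + Δ) ^ 2 * C ^ 2 * D) with hc
  have hc0 : 0 < c := by positivity
  have hlog : ∀ᶠ n : ℕ in atTop, 1 ≤ Real.log n :=
    (Real.tendsto_log_atTop.comp tendsto_natCast_atTop_atTop).eventually_ge_atTop 1
  have hKpos : ∀ᶠ n in atTop, 0 < K n := by
    filter_upwards [hK] with n hn
    refine Nat.pos_of_ne_zero fun h => ?_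
    rw [h] at hn
    simp at hn
  refine ⟨fun n => c * ((n : ℝ) ^ (β - γ) * (1 / Real.log n ^ 2)), ?_, ?_, ?_⟩
  · filter_upwards [hlog, eventually_gt_atTop 0] with n hn hn0
    have hn0' : (0 : ℝ) < n := by exact_mod_cast hn0
    have : 0 < Real.log n := by linarith
    positivity
  · exact (isTheta_refl _ _).const_mul_left hc0.ne'
  refine tendsto_of_tendsto_of_tendsto_of_le_of_le' tendsto_const_nhds
    (Femtocache.tendsto_uniformPositions_compl_occupied hKpos ha hKa)
    (Eventually.of_forall fun _ => zero_le) ?_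
  filter_upwards [hlog, eventually_gt_atTop 0, hKpos, hK, hKa, hρC,
    Femtocache.eventually_half_mul_rpow_le hC₃ hm, Femtocache.eventually_half_mul_rpow_le hC₄ hM]
    with n hlogn hn hKn hKρ hKan hρn hmn hMn
  -- Placements that fail to sustain the rate are not occupied; monotonicity of measure needs no
  -- measurability of the failure set.
  refine measure_mono fun Y hY hocc => hY ?_
  have hn' : (1 : ℝ) ≤ n := by exact_mod_cast hn
  have hn0 : (0 : ℝ) < n := by linarith
  have hlog0 : 0 < Real.log n := by linarith
  have hKn' : (0 : ℝ) < K n := by exact_mod_cast hKn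
  have hm0 : 0 < m n := by
    have : (0 : ℝ) < m n := lt_of_lt_of_le (by positivity) hmn
    exact_mod_cast this
  have hM0' : (0 : ℝ) < M n := lt_of_lt_of_le (by positivity) hMn
  have hM0 : 0 < M n := by exact_mod_cast hM0'
  have hρ0 : ρ n ≠ 0 := by
    intro h
    rw [h] at hKρ
    simp at hKρ
  have hρK : 5 < (K n * ρ n) ^ 2 := by
    have h1 : K n * ρ n = 1 / C₁ := by rw [eq_div_iff hC₁.ne']; linarith
    have h2 : √5 < 1 / C₁ := (lt_div_iff₀ hC₁).2 hC₁'
    rw [h1]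
    calc (5 : ℝ) = √5 ^ 2 := (Real.sq_sqrt (by norm_num)).symm
      _ < (1 / C₁) ^ 2 := pow_lt_pow_left₀ h2 (by positivity) (by norm_num)
  refine Femtocache.sustainsRate_of_mem_occupied hocc hKn hρK hm0 hM0 (by positivity) ?_
  have hhops : (Femtocache.popularCount s (m n) (1 / √(n : ℝ)) : ℝ) / M n + 1 +
      1 / √(n : ℝ) * (2 * K n + 1 : ℕ) ≤ D * (n : ℝ) ^ (γ - β) := by
    have h1 : (1 : ℝ) ≤ (n : ℝ) ^ (γ - β) := Real.one_le_rpow hn' (by linarith)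
    have h2 : (Femtocache.popularCount s (m n) (1 / √(n : ℝ)) : ℝ) / M n ≤
        2 * B / C₄ * (n : ℝ) ^ (γ - β) := by
      calc _ ≤ B * (n : ℝ) ^ γ / (C₄ / 2 * (n : ℝ) ^ β) :=
            div_le_div₀ (by positivity) (hpop n (m n) hn hm0) (by positivity) hMn
        _ = _ := by
            rw [Real.rpow_sub hn0]
            field_simp
    have h3 : (K n : ℝ) ≤ √n := by
      refine Real.le_sqrt_of_sq_le (le_trans ?_ hKan)
      exact le_mul_of_one_le_left (by positivity)
        (one_le_mul_of_one_le_of_one_le ha.le hlogn)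
    have h4 : 1 ≤ √(n : ℝ) := Real.one_le_sqrt.2 hn'
    have h5 : 1 / √(n : ℝ) * (2 * K n + 1 : ℕ) ≤ 3 := by
      rw [one_div_mul_eq_div, div_le_iff₀ (by linarith)]
      push_cast
      linarith
    rw [hD]
    linarith
  have hρsq : ρ n ^ 2 ≤ C ^ 2 * (Real.log n / n) := by
    have hq : 0 ≤ Real.log n / n := by positivity
    rw [Real.norm_eq_abs, Real.norm_eq_abs, abs_of_nonneg (Real.sqrt_nonneg _)] at hρn
    calc ρ n ^ 2 = |ρ n| ^ 2 := (sq_abs _).symm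
      _ ≤ (C * √(Real.log n / n)) ^ 2 := pow_le_pow_left₀ (abs_nonneg _) hρn 2
      _ = _ := by rw [mul_pow, Real.sq_sqrt hq]
  calc n * (c * ((n : ℝ) ^ (β - γ) * (1 / Real.log n ^ 2))) * _
      ≤ n * (c * ((n : ℝ) ^ (β - γ) * (1 / Real.log n ^ 2))) * (D * (n : ℝ) ^ (γ - β)) :=
        mul_le_mul_of_nonneg_left hhops (by positivity)
    _ = c * D * (n / Real.log n ^ 2) := by
        have : (n : ℝ) ^ (β - γ) * (n : ℝ) ^ (γ - β) = 1 := by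
          rw [← Real.rpow_add hn0]; simp
        linear_combination (c * D * (n / Real.log n ^ 2)) * this
    -- The spare factor `log n` is given up here.
    _ ≤ c * D * (n / Real.log n) := by
        gcongr
        exact le_self_pow₀ hlogn (by norm_num)
    _ = W / ((2 + Δ) ^ 2 * (C ^ 2 * (Real.log n / n))) := by
        rw [hc]
        field_simp
    _ ≤ W / ((2 + Δ) ^ 2 * ρ n ^ 2) := by gcongr
    _ = Femtocache.transportCapacity W Δ C₁ (ρ n) := by
        rw [Femtocache.transportCapacity, div_mul_cancel₀ _ hC₁.ne', mul_pow]
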